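/- Let $\mathbf K$ be a (locally small) category that has all small colimits, let $\mathbf{Pro}(\mathbf K)$ be its pro-category, and let $X$ be a topological space. $\mathbf{Pro}(\mathbf K)$ is the opposite of the full subcategory of $\mathbf{Set}^{\mathbf K}$ consisting of small filtered colimits of representable functors. A precosheaf on $X$ with values in $\mathbf{Pro}(\mathbf K)$ is a functor $\mathcal A$ from the poset of open subsets of $X$ (with inclusions as morphisms) to $\mathbf{Pro}(\mathbf K)$. It is a cosheaf if $\varinjlim_{(V\subseteq U)\in R}\mathcal A(V)\to\mathcal A(U)$ is an isomorphism for every open $U\subseteq X$ and every covering sieve $R$ over $U$ (a downward closed family of open subsets of $U$ whose union is $U$). The costalk of $\mathcal A$ at $x\in X$ is $\mathcal A^x=\varprojlim_{U\ni x}\mathcal A(U)$, where $U$ runs over the open neighbourhoods of $x$ and the limit is taken in $\mathbf{Pro}(\mathbf K)$. A morphism $\mathcal A\to\mathcal B$ of precosheaves is a strong local isomorphism (a local isomorphism in the sense of Bredon) if $\mathcal A^x\to\mathcal B^x$ is an isomorphism for every $x\in X$. Then every precosheaf $\mathcal A$ on $X$ with values in $\mathbf{Pro}(\mathbf K)$ is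 smooth, in both of the following forms: there are a precosheaf $\mathcal B$, a cosheaf $\mathcal C$ and strong local isomorphisms $\mathcal A\to\mathcal B\leftarrow\mathcal C$; and there are a precosheaf $\mathcal B'$, a cosheaf $\mathcal C'$ and strong local isomorphisms $\mathcal A\leftarrow\mathcal B'\to\mathcal C'$. More precisely, the inclusion of the full subcategory of cosheaves into precosheaves with values in $\mathbf{Pro}(\mathbf K)$ has a right adjoint $\mathcal A\mapsto\mathcal A_\#$ (cosheafification), and for every precosheaf $\mathcal A$ the counit $\mathcal A_\#\to\mathcal A$ is a strong local isomorphism from a cosheaf to $\mathcal A$. -/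

import Mathlib

open CategoryTheory CategoryTheory.Limits TopologicalSpace

universe v u w

namespace ProCosheaf

/-- The pro-category of `K`. The category `Ind Kᵒᵖ` is the full subcategory of functors
`Kᵒᵖᵒᵖ ⥤ Type v` (that is, of covariant set-valued functors on `K`) consisting of the small
filtered colimits of representable functors, and `Pro K` is its opposite. -/
abbrev Pro (K : Type u) [Category.{v} K] : Type (max u (v + 1)) := (Ind Kᵒᵖ)ᵒᵖ

/-- Precosheaves on `X` with values in `L`: covariant functors on the poset of open subsets. -/
abbrev Precosheaf (X : TopCat.{v}) (L : Type w) [Category.{v} L] : Type (max v w) :=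
  Opens X ⥤ L

/-- A precosheaf `A` is a cosheaf if, for every open `U` and every covering sieve `R` over `U`,
the canonical cocone exhibits `A U` as the colimit of the values `A V`, for `V ⟶ U` in `R`. -/
def isCosheaf (X : TopCat.{v}) (L : Type w) [Category.{v} L] :
    ObjectProperty (Precosheaf X L) :=
  fun A => ∀ (U : Opens X) (R : Sieve U), R ∈ Opens.grothendieckTopology X U →
    Nonempty (IsColimit (A.mapCocone R.arrows.cocone))

/-- The full subcategory of cosheaves. -/
abbrev Cosheaf (X : TopCat.{v}) (L : Type w) [Category.{v} L] : Type (max v w) :=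
  (isCosheaf X L).FullSubcategory

/-- The costalk at `x`: the limit, over the open neighbourhoods of `x`, of the values. It is a
functor of the precosheaf. -/
noncomputable def costalk {X : TopCat.{v}} (L : Type w) [Category.{v} L] [HasCofilteredLimits L]
    (x : X) : Precosheaf X L ⥤ L :=
  (Functor.whiskeringLeft _ _ L).obj (OpenNhds.inclusion x) ⋙ lim

section

variable {X : TopCat.{v}} {K : Type u} [Category.{v} K]

/-- A strong local isomorphism (a local isomorphism in the sense of Bredon) of precosheaves of
pro-objects: the induced morphism of costalks, computed in `Pro K`, is an isomorphism at every
point. -/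
def IsStrongLocalIso {A B : Precosheaf X (Pro K)} (f : A ⟶ B) : Prop :=
  ∀ x : X, IsIso ((costalk (Pro K) x).map f)

/-- `A` is smooth: there are strong local isomorphisms `A ⟶ B ⟵ C` with `C` a cosheaf. -/
def IsSmooth (A : Precosheaf X (Pro K)) : Prop :=
  ∃ (B C : Precosheaf X (Pro K)) (f : A ⟶ B) (g : C ⟶ B),
    isCosheaf X (Pro K) C ∧ IsStrongLocalIso f ∧ IsStrongLocalIso g

/-- The other form of smoothness: there are strong local isomorphisms `A ⟵ B' ⟶ C` with `C` a
cosheaf. -/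
def IsSmooth' (A : Precosheaf X (Pro K)) : Prop :=
  ∃ (B' C : Precosheaf X (Pro K)) (f : B' ⟶ A) (g : B' ⟶ C),
    isCosheaf X (Pro K) C ∧ IsStrongLocalIso f ∧ IsStrongLocalIso g

end

end ProCosheaf

open Opposite

namespace ProCosheaf

section Plus

variable {C : Type u} [Category.{v} C]

/-! Dually, a precosheaf in `Pro K` is a presheaf with values in `Ind C`, `C = Kᵒᵖ`, and costalks
become stalks. The functors `indEval c` jointly detect isomorphisms and limits, and they preserve
limits and filtered colimits. The plus construction and stalks are built from exactly these, so both
are computed after `indEval c`, in sets. There `P⁺⁺` is a sheaf and `P ⟶ P⁺` is an isomorphism on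
stalks. Hence `A⁺⁺`, read back in `Pro K`, is the cosheafification, and its counit is a strong local
isomorphism; smoothness follows by pairing it with an identity. -/

/-- The sections of an ind-object, seen as a presheaf on `C`, over an object of `C`. -/
noncomputable abbrev indEval (c : Cᵒᵖ) : Ind C ⥤ Type v :=
  Ind.inclusion C ⋙ (evaluation Cᵒᵖ (Type v)).obj c

lemma isSheaf_of_isSheaf_comp_indEval {D : Type v} [SmallCategory D] (J : GrothendieckTopology D)
    (P : Dᵒᵖ ⥤ Ind C) (h : ∀ c : Cᵒᵖ, Presheaf.IsSheaf J (P ⋙ indEval c)) :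
    Presheaf.IsSheaf J P := by
  refine Presheaf.isSheaf_of_isSheaf_comp J P (Ind.inclusion C) ?_
  rw [Presheaf.isSheaf_iff_isLimit]
  intro U S hS
  refine ⟨evaluationJointlyReflectsLimits _ fun c => ?_⟩
  exact ((Presheaf.isSheaf_iff_isLimit J _).1 (h c) S hS).some

lemma isIso_of_isIso_indEval {Y Z : Ind C} (f : Y ⟶ Z)
    (h : ∀ c : Cᵒᵖ, IsIso ((indEval c).map f)) : IsIso f := by
  suffices IsIso ((Ind.inclusion C).map f) from isIso_of_reflects_iso f (Ind.inclusion C)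
  have : ∀ c, IsIso (((Ind.inclusion C).map f).app c) := h
  exact NatIso.isIso_of_isIso_app _

lemma isSheaf_plusObj_plusObj [HasLimits C] {D : Type v} [SmallCategory D]
    (J : GrothendieckTopology D) (P : Dᵒᵖ ⥤ Ind C) :
    Presheaf.IsSheaf J (J.plusObj (J.plusObj P)) := by
  refine isSheaf_of_isSheaf_comp_indEval J _ fun c => ?_
  let e : J.plusObj (J.plusObj P) ⋙ indEval c ≅ J.plusObj (J.plusObj (P ⋙ indEval c)) :=
    J.plusCompIso (indEval c) (J.plusObj P) ≪≫
      (J.plusFunctor (Type v)).mapIso (J.plusCompIso (indEval c) P)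
  exact (Presheaf.isSheaf_of_iso_iff e).2
    (GrothendieckTopology.Plus.isSheaf_plus_plus J (P ⋙ indEval c))

end Plus

section Stalks

variable {X : TopCat.{v}}

/-- Maps from the stalk at `x` to a set `T` are maps to the skyscraper sheaf of `T` at `x`, so
Yoneda applies. -/
lemma isIso_stalkFunctor_map_of_bijective_precomp {P Q : TopCat.Presheaf (Type v) X} (f : P ⟶ Q)
    (h : ∀ R : TopCat.Presheaf (Type v) X, R.IsSheaf →
      Function.Bijective fun g : Q ⟶ R => f ≫ g) (x : X) :
    IsIso ((TopCat.Presheaf.stalkFunctor (Type v) x).map f) := by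
  classical
  rw [isIso_iff_coyoneda_map_bijective]
  intro T
  let adj := skyscraperPresheafStalkAdjunction (C := Type v) x
  have key : (fun g => (TopCat.Presheaf.stalkFunctor (Type v) x).map f ≫ g) =
      (adj.homEquiv P T).symm ∘ (fun g => f ≫ g) ∘ adj.homEquiv Q T := by
    funext g
    exact (((adj.homEquiv_naturality_left_symm f (adj.homEquiv Q T g))).trans
      (by rw [Equiv.symm_apply_apply])).symm
  rw [key]
  exact (adj.homEquiv P T).symm.bijective.comp
    ((h _ (skyscraperPresheaf_isSheaf x T)).comp (adj.homEquiv Q T).bijective)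

lemma isIso_stalkFunctor_map_toPlus (P : TopCat.Presheaf (Type v) X) (x : X) :
    IsIso ((TopCat.Presheaf.stalkFunctor (Type v) x).map
      ((Opens.grothendieckTopology X).toPlus P)) := by
  refine isIso_stalkFunctor_map_of_bijective_precomp _ (fun R hR => ⟨fun g g' hg => ?_, fun g => ?_⟩) x
  · exact (Opens.grothendieckTopology X).plus_hom_ext _ _ hR hg
  · exact ⟨_, (Opens.grothendieckTopology X).toPlus_plusLift g hR⟩

variable {C : Type u} [Category.{v} C] [HasLimits C]

lemma isIso_stalkFunctor_map_whiskerRight_toPlus (P : (Opens X)ᵒᵖ ⥤ Ind C) (c : Cᵒᵖ) (x : X) :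
    IsIso ((TopCat.Presheaf.stalkFunctor (Type v) x).map
      (Functor.whiskerRight ((Opens.grothendieckTopology X).toPlus P) (indEval c))) := by
  rw [← GrothendieckTopology.toPlus_comp_plusCompIso_inv, Functor.map_comp]
  have := isIso_stalkFunctor_map_toPlus (P ⋙ indEval c) x
  infer_instance

/-- Serves to pass from the chosen stalks in `Type v` to the images of colimits in `Ind C`. -/
lemma isIso_of_isColimit {J : Type*} [Category* J] {E : Type*} [Category* E] {F G : J ⥤ E}
    (α : F ⟶ G) {s s' : Cocone F} {t t' : Cocone G}
    (hs : IsColimit s) (hs' : IsColimit s') (ht : IsColimit t) (ht' : IsColimit t')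
    (f : s.pt ⟶ t.pt) (hf : ∀ j, s.ι.app j ≫ f = α.app j ≫ t.ι.app j)
    (f' : s'.pt ⟶ t'.pt) (hf' : ∀ j, s'.ι.app j ≫ f' = α.app j ≫ t'.ι.app j) [IsIso f] :
    IsIso f' := by
  have : f' = (hs'.coconePointUniqueUpToIso hs).hom ≫ f ≫
      (ht.coconePointUniqueUpToIso ht').hom := by
    refine hs'.hom_ext fun j => ?_
    rw [hf', IsColimit.comp_coconePointUniqueUpToIso_hom_assoc, reassoc_of% hf j,
      IsColimit.comp_coconePointUniqueUpToIso_hom]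
  rw [this]
  infer_instance

end Stalks

section Pro

variable {X : TopCat.{v}} {K : Type u} [Category.{v} K]

lemma isCosheaf_iff_isSheaf_leftOp (A : Precosheaf X (Pro K)) :
    isCosheaf X (Pro K) A ↔ Presheaf.IsSheaf (Opens.grothendieckTopology X) A.leftOp := by
  rw [Presheaf.isSheaf_iff_isLimit]
  refine forall_congr' fun U => forall_congr' fun S => forall_congr' fun _ => ⟨?_, ?_⟩
  · rintro ⟨h⟩
    exact ⟨isLimitConeLeftOpOfCocone _ h⟩
  · rintro ⟨h⟩
    exact ⟨isColimitOfConeLeftOpOfCocone _ h⟩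

lemma isIso_costalk_map {A B : Precosheaf X (Pro K)} (f : A ⟶ B) (x : X)
    (h : ∀ c, IsIso ((TopCat.Presheaf.stalkFunctor (Type v) x).map
      (Functor.whiskerRight (NatTrans.leftOp f) (indEval c)))) :
    IsIso ((costalk (Pro K) x).map f) := by
  suffices IsIso ((costalk (Pro K) x).map f).unop from (isIso_unop_iff _).1 this
  refine isIso_of_isIso_indEval _ fun c => ?_
  have : IsIso (colimMap (Functor.whiskerLeft (OpenNhds.inclusion x).op
      (Functor.whiskerRight (NatTrans.leftOp f) (indEval c)))) := h c
  refine isIso_of_isColimit (J := (OpenNhds x)ᵒᵖ)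
    (Functor.whiskerLeft (OpenNhds.inclusion x).op
      (Functor.whiskerRight (NatTrans.leftOp f) (indEval c)))
    (colimit.isColimit _)
    -- The neighbourhoods of `x` are cofiltered, so the costalk is a filtered colimit in `Ind C`,
    -- which `indEval c` preserves. Passing to opposites swaps `A` and `B`.
    (isColimitOfPreserves (indEval c) (isColimitCoconeLeftOpOfCone _ (limit.isLimit
      (OpenNhds.inclusion x ⋙ B))))
    (colimit.isColimit _)
    (isColimitOfPreserves (indEval c) (isColimitCoconeLeftOpOfCone _ (limit.isLimit
      (OpenNhds.inclusion x ⋙ A))))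
    (colimMap _) (fun j => ι_colimMap _ j) _ ?_
  · intro j
    have : (costalk (Pro K) x).map f ≫ limit.π (OpenNhds.inclusion x ⋙ B) j.unop =
        limit.π (OpenNhds.inclusion x ⋙ A) j.unop ≫ f.app _ := limMap_π _ _
    exact ((indEval c).map_comp _ _).symm.trans
      ((congrArg (fun g => (indEval c).map g.unop) this).trans ((indEval c).map_comp _ _))

variable [HasColimits K]

/-- The cosheaf associated with a precosheaf of pro-objects: the opposite of the plus construction
applied twice to the corresponding presheaf of ind-objects. -/
noncomputable def cosheafify (A : Precosheaf X (Pro K)) : Precosheaf X (Pro K) :=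
  ((Opens.grothendieckTopology X).plusObj
    ((Opens.grothendieckTopology X).plusObj A.leftOp)).rightOp

/-- The canonical morphism from the associated cosheaf to a precosheaf. -/
noncomputable def fromCosheafify (A : Precosheaf X (Pro K)) : cosheafify A ⟶ A :=
  NatTrans.rightOp ((Opens.grothendieckTopology X).toPlus A.leftOp ≫
    (Opens.grothendieckTopology X).toPlus _)

lemma isCosheaf_cosheafify (A : Precosheaf X (Pro K)) : isCosheaf X (Pro K) (cosheafify A) :=
  (isCosheaf_iff_isSheaf_leftOp _).2 (isSheaf_plusObj_plusObj _ A.leftOp)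

lemma isStrongLocalIso_fromCosheafify (A : Precosheaf X (Pro K)) :
    IsStrongLocalIso (fromCosheafify A) := by
  intro x
  refine isIso_costalk_map _ x fun c => ?_
  have h₁ := isIso_stalkFunctor_map_whiskerRight_toPlus A.leftOp c x
  have h₂ := isIso_stalkFunctor_map_whiskerRight_toPlus
    ((Opens.grothendieckTopology X).plusObj A.leftOp) c x
  have : IsIso ((TopCat.Presheaf.stalkFunctor (Type v) x).map
      (Functor.whiskerRight ((Opens.grothendieckTopology X).toPlus A.leftOp ≫
        (Opens.grothendieckTopology X).toPlus _) (indEval c))) := by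
    rw [Functor.whiskerRight_comp, Functor.map_comp]
    infer_instance
  exact this

lemma bijective_comp_fromCosheafify (A : Precosheaf X (Pro K)) {B : Precosheaf X (Pro K)}
    (hB : isCosheaf X (Pro K) B) :
    Function.Bijective fun g : B ⟶ cosheafify A => g ≫ fromCosheafify A := by
  have hB' := (isCosheaf_iff_isSheaf_leftOp B).1 hB
  let J := Opens.grothendieckTopology X
  refine ⟨fun g g' h => ?_, fun g => ?_⟩
  · let γ : J.plusObj (J.plusObj A.leftOp) ⟶ B.leftOp := NatTrans.leftOp g
    let γ' : J.plusObj (J.plusObj A.leftOp) ⟶ B.leftOp := NatTrans.leftOp g'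
    have h' : (J.toPlus A.leftOp ≫ J.toPlus _) ≫ γ = (J.toPlus A.leftOp ≫ J.toPlus _) ≫ γ' :=
      congrArg NatTrans.leftOp h
    rw [Category.assoc, Category.assoc] at h'
    exact congrArg NatTrans.rightOp (J.plus_hom_ext _ _ hB' (J.plus_hom_ext _ _ hB' h'))
  · refine ⟨NatTrans.rightOp (J.plusLift (J.plusLift (NatTrans.leftOp g) hB') hB'), ?_⟩
    have : (J.toPlus A.leftOp ≫ J.toPlus _) ≫ J.plusLift (J.plusLift (NatTrans.leftOp g) hB') hB' =
        NatTrans.leftOp g := by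
      rw [Category.assoc, J.toPlus_plusLift, J.toPlus_plusLift]
    exact congrArg NatTrans.rightOp this

end Pro

/-- Objectwise couniversal arrows assemble into an adjunction; `G` need not be given on morphisms,
and the counit is recorded so that it can be identified with `ε`. -/
lemma exists_rightAdjoint_of_bijective_comp {L : Type w} [Category.{v} L] (P : ObjectProperty L)
    (G : L → L) (hG : ∀ A, P (G A)) (ε : ∀ A, G A ⟶ A)
    (h : ∀ A B, P B → Function.Bijective fun g : B ⟶ G A => g ≫ ε A) :
    ∃ (R : L ⥤ P.FullSubcategory) (adj : P.ι ⊣ R) (e : ∀ A, (R.obj A).obj = G A),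
      ∀ A, adj.counit.app A = eqToHom (e A) ≫ ε A := by
  let e : ∀ (B : P.FullSubcategory) (A : L), (P.ι.obj B ⟶ A) ≃ (B ⟶ ⟨G A, hG A⟩) := fun B A =>
    (Equiv.ofBijective (fun g : B.obj ⟶ G A => g ≫ ε A) (h A B.obj B.property)).symm.trans
      (P.fullyFaithfulι.homEquiv (X := B) (Y := ⟨G A, hG A⟩)).symm
  have he : ∀ (B' B : P.FullSubcategory) (A : L) (f : B' ⟶ B) (g : P.ι.obj B ⟶ A),
      e B' A (P.ι.map f ≫ g) = f ≫ e B A g := by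
    intro B' B A f g
    obtain ⟨g, rfl⟩ := (e B A).symm.surjective g
    rw [Equiv.apply_symm_apply, ← Equiv.eq_symm_apply]
    exact (Category.assoc _ _ _).symm
  refine ⟨_, Adjunction.adjunctionOfEquivRight e he, fun A => rfl, fun A => ?_⟩
  rw [eqToHom_refl, Category.id_comp]
  exact (Category.id_comp (ε A))

end ProCosheaf

theorem corollary2p5 (K : Type u) [Category.{v} K] [HasColimits K] (X : TopCat.{v}) :
    (∀ A : ProCosheaf.Precosheaf X (ProCosheaf.Pro K),
      ProCosheaf.IsSmooth A ∧ ProCosheaf.IsSmooth' A) ∧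
    ∃ (cosheafification : ProCosheaf.Precosheaf X (ProCosheaf.Pro K) ⥤
          ProCosheaf.Cosheaf X (ProCosheaf.Pro K))
        (adj : (ProCosheaf.isCosheaf X (ProCosheaf.Pro K)).ι ⊣ cosheafification),
      ∀ A : ProCosheaf.Precosheaf X (ProCosheaf.Pro K),
        ProCosheaf.IsStrongLocalIso (adj.counit.app A) := by
  refine ⟨fun A => ⟨⟨A, _, 𝟙 A, ProCosheaf.fromCosheafify A, ProCosheaf.isCosheaf_cosheafify A,
    fun x => inferInstance, ProCosheaf.isStrongLocalIso_fromCosheafify A⟩,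
    ⟨_, _, ProCosheaf.fromCosheafify A, 𝟙 _, ProCosheaf.isCosheaf_cosheafify A,
    ProCosheaf.isStrongLocalIso_fromCosheafify A, fun x => inferInstance⟩⟩, ?_⟩
  obtain ⟨R, adj, e, he⟩ := ProCosheaf.exists_rightAdjoint_of_bijective_comp
    (ProCosheaf.isCosheaf X (ProCosheaf.Pro K)) ProCosheaf.cosheafify
    ProCosheaf.isCosheaf_cosheafify ProCosheaf.fromCosheafify
    (fun A _ hB => ProCosheaf.bijective_comp_fromCosheafify A hB)
  refine ⟨R, adj, fun A x => ?_⟩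
  have := ProCosheaf.isStrongLocalIso_fromCosheafify A x
  rw [he, Functor.map_comp]
  infer_instance
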